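/- A $\langle\vee,0\rangle$-semilattice $S$ is \emph{distributive} if for all $a,b,c\in S$ with $c\le a\vee b$ there are $x\le a$ and $y\le b$ in $S$ with $c=x\vee y$. An \emph{$S$-valued p-measure} on a poset $P$ is a map $\mu\colon P\times P\to S$ such that $\mu(x,z)\le\mu(x,y)\vee\mu(y,z)$ for all $x,y,z\in P$, and $\mu(x,y)=0$ whenever $x\le y$ in $P$. For every distributive $\langle\vee,0\rangle$-semilattice $S$ there are a $\langle\wedge,0\rangle$-semilattice $P$, in which every finite subset that is bounded above has a join, and an $S$-valued p-measure $\mu$ on $P$ such that: (i) $\mu(y,x)>0$ for all $x<y$ in $P$; (ii) for all $x\le y$ in $P$ and all $a,b\in S$ with $\mu(y,x)\le a\vee b$, there are a positive integer $n$ and a decomposition $x=z_0\le z_1\le\dots\le z_n=y$ in $P$ such that, for each $i<n$, either $\mu(z_{i+1},z_i)\le a$ or $\mu(z_{i+1},z_i)\le b$; (iii) the set $\{\mu(x,0)\mid x\in P\}$ generates the semilattice $S$. Furthermore, if $S$ is bounded (that is, has a largest element), then $P$ and $\mu$ satisfying (i)--(iii) can be chosen with $P$ a bounded lattice. -/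

import Mathlib

universe u v

/-- A join-semilattice is distributive if every `c ≤ a ⊔ b` splits as `c = x ⊔ y` with
`x ≤ a` and `y ≤ b`. -/
def IsDistributiveSemilattice (S : Type u) [SemilatticeSup S] : Prop :=
  ∀ a b c : S, c ≤ a ⊔ b → ∃ x y : S, x ≤ a ∧ y ≤ b ∧ c = x ⊔ y

/-- `μ : P × P → S` is an `S`-valued p-measure on the poset `P`. -/
structure IsPMeasure {S : Type u} [SemilatticeSup S] [OrderBot S] {P : Type v} [PartialOrder P]
    (μ : P → P → S) : Prop where
  /-- The triangular inequality. -/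
  triangle : ∀ x y z : P, μ x z ≤ μ x y ⊔ μ y z
  eq_bot_of_le : ∀ x y : P, x ≤ y → μ x y = ⊥

/-- `μ` is an `S`-valued p-measure on the poset with zero `P` which is positive on strict pairs,
has the refinement property along chains, and whose values `μ(x, 0)` generate `S`. -/
structure IsPMeasureRepresentation {S : Type u} [SemilatticeSup S] [OrderBot S]
    {P : Type v} [PartialOrder P] [OrderBot P] (μ : P → P → S) : Prop
    extends IsPMeasure μ where
  /-- `μ(y, x) > 0` for all `x < y`. -/
  pos : ∀ x y : P, x < y → ⊥ < μ y x
  /-- If `x ≤ y` and `μ(y, x) ≤ a ∨ b`, there is a chain `x = z 0 ≤ z 1 ≤ ⋯ ≤ z n = y` with `n ≥ 1`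
  such that, for each `i < n`, `μ(z (i+1), z i)` is below `a` or below `b`. -/
  refine : ∀ x y : P, x ≤ y → ∀ a b : S, μ y x ≤ a ⊔ b →
    ∃ n : ℕ, 0 < n ∧ ∃ z : Fin (n + 1) → P, z 0 = x ∧ z (Fin.last n) = y ∧
      (∀ i : Fin n, z i.castSucc ≤ z i.succ) ∧
      ∀ i : Fin n, μ (z i.succ) (z i.castSucc) ≤ a ∨ μ (z i.succ) (z i.castSucc) ≤ b
  /-- Every element of `S` is a join of finitely many values `μ(x, 0)`; as `μ(0, 0) = 0`, closing
  under binary joins is the same as closing under binary joins and zero. -/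
  generates : supClosure (Set.range fun x : P => μ x ⊥) = Set.univ

/-!
The posets are built from copies of one interval that reproduces itself. Fix `c : S`, the intended
value of `μ(1, 0)`. To every pair `i = (a, b)` with `a ⊔ b = c` attach a chain from `0` to `1` whose
four consecutive pieces carry the values `a, b, a, b`, let chains with different `i` be incomparable
in their interiors, and let each piece be again such an interval, built over `a` or over `b`
(`Point`, `part`). As an order this is a horizontal sum of chains of smaller copies of itself, hence
a bounded lattice (`inf_le`, `le_inf`, `le_sup`, `sup_le`). The chain indexed by `(a, b)` realizes
the splitting `c = a ⊔ b`, and repeating this inside the pieces gives the refinement property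
(`Path.whole`, `exists_path`).

What makes a p-measure exist is that every splitting is repeated. A point `x` of the lower half
`a, b` of a chain satisfies `μ(1, x) = c`, and a point of the upper half satisfies `μ(x, 0) = c`.
For points of two different chains one puts
`μ(x, y) = μ(x, 0)` if `y` is in a lower half, `μ(x, y) = μ(1, y)` if `x` is in an upper half, and
only for `x` in a lower and `y` in an upper half is there something to choose: a substitute for the
meet of `μ(x, 0)` and `μ(1, y)`. Suppose `x`, `z` lie on one chain and `y` on another. If `y` is low
then `μ(x, y) = μ(x, 0) ≥ μ(x, z)`, and if `y` is high then `μ(y, z) = μ(1, z) ≥ μ(x, z)`, so the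
chosen values play no role. Every other case of the triangular inequality either takes place on a
single chain or is a Lipschitz condition in one variable. Therefore the substitutes for different
pairs of chains can be chosen independently of each other, although `S` has no meets
(`mu_triangle`).

For a single pair of chains the choice is the function `sheet` of two variables, monotone and
Lipschitz in each of them. It is constructed by repeated bisection, and one bisection is an
interpolation problem with finitely many constraints, which distributivity solves
(`isMidpoint_midpoint`). The Lipschitz conditions are formulated locally (`Admissible`), and
`le_mu_sup_of_rise` and `le_sup_mu_of_fall` turn them into inequalities involving `μ`.

If `S` has a largest element `t ≠ ⊥`, the interval over `t` is the bounded lattice sought. In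
general the construction is applied to `WithTop S` and restricted to the points whose height is not
`⊤`; they form a lower set, in which finite bounded subsets keep their joins.
-/

/-! ### Points of the doubled interval -/

namespace DoubledInterval

/-- Points of one half of the doubled interval: its two ends, and, for each index `i`, the two
pieces of a chain, each a smaller copy of the same object. The end of the first piece is meant to be
the beginning of the second. -/
inductive HalfPoint (ι : Type u) : Type u
  | bot : HalfPoint ι
  | top : HalfPoint ι
  | piece (i : ι) (p : Bool) (t : HalfPoint ι) : HalfPoint ι

/-- Points of the doubled interval over an index type `ι`: its ends, and, for each index `i`, a
chain of four pieces, each a copy of the whole. The Booleans say in which half (`h`) and in which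
piece of that half (`p`) the point `t` lies, `false` being below `true`. Ends of pieces are
represented several times, for instance `bot` and `piece i false false bot` are the same point of
the interval, so that the order below is only a preorder. -/
inductive Point (ι : Type u) : Type u
  | bot : Point ι
  | top : Point ι
  | piece (i : ι) (h p : Bool) (t : Point ι) : Point ι

/-- The part of a point below the midpoint of its chain, as a coordinate in the lower half: the
upper half is collapsed to `top`, here and inside all the pieces. -/
def lower {ι : Type u} : Point ι → HalfPoint ι
  | .bot => .bot
  | .top => .top
  | .piece i false p t => .piece i p (lower t)
  | .piece _ true _ _ => .top

/-- The part of a point above the midpoint of its chain, as a coordinate in the upper half: the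
lower half is collapsed to `bot`, here and inside all the pieces. -/
def upper {ι : Type u} : Point ι → HalfPoint ι
  | .bot => .bot
  | .top => .top
  | .piece _ false _ _ => .bot
  | .piece i true p t => .piece i p (upper t)

theorem upper_eq_bot_or_lower_eq_top {ι : Type u} (x : Point ι) :
    upper x = .bot ∨ lower x = .top := by
  rcases x with _ | _ | ⟨i, _ | _, p, t⟩ <;> simp [upper, lower]

variable {S : Type u} [SemilatticeSup S] [OrderBot S]

open Classical in
/-- The value carried by the pieces of the chain `i` in an interval of value `c`. A pair `i` that
is not a splitting of `c` into two nonzero elements is replaced by the splitting `c = c ⊔ c`, so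
that the index type does not depend on `c` and a nonzero interval has nonzero pieces. -/
noncomputable def part (c : S) (i : S × S) (p : Bool) : S :=
  if i.1 ≠ ⊥ ∧ i.2 ≠ ⊥ ∧ i.1 ⊔ i.2 = c then (if p then i.2 else i.1) else c

theorem part_sup_part (c : S) (i : S × S) : part c i false ⊔ part c i true = c := by
  unfold part
  split_ifs with h <;> simp_all

theorem part_ne_bot {c : S} (hc : c ≠ ⊥) (i : S × S) (p : Bool) : part c i p ≠ ⊥ := by
  unfold part
  split_ifs with h <;> simp_all

theorem part_le (c : S) (i : S × S) (p : Bool) : part c i p ≤ c := by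
  conv_rhs => rw [← part_sup_part c i]
  cases p <;> simp

/-- The value `μ(x, 0)` in an interval of value `c`, in terms of the lower coordinate of `x`. -/
noncomputable def height : S → HalfPoint (S × S) → S
  | _, .bot => ⊥
  | c, .top => c
  | c, .piece i false t => height (part c i false) t
  | c, .piece i true t => part c i false ⊔ height (part c i true) t

/-- The value `μ(1, x)` in an interval of value `c`, in terms of the upper coordinate of `x`. -/
noncomputable def depth : S → HalfPoint (S × S) → S
  | c, .bot => c
  | _, .top => ⊥
  | c, .piece i false t => depth (part c i false) t ⊔ part c i true
  | c, .piece i true t => depth (part c i true) t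

/-! ### Admissible functions on a half -/

/-- `e` takes the same value at points to be identified, and its end values on the whole half and,
at every depth, on each piece are related by `β`, which also depends on the value of the piece.
This is the largest relation `R` closed under passing to the pieces, so that admissibility is
proved by exhibiting such an `R`. -/
def Admissible (β : S → S → S → Prop) (c : S) (e : HalfPoint (S × S) → S) : Prop :=
  ∃ R : S → (HalfPoint (S × S) → S) → Prop, R c e ∧ ∀ c e, R c e →
    β c (e .bot) (e .top) ∧ ∀ i,
      e (.piece i false .bot) = e .bot ∧
      e (.piece i false .top) = e (.piece i true .bot) ∧
      e (.piece i true .top) = e .top ∧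
      ∀ p, R (part c i p) (fun t => e (.piece i p t))

namespace Admissible

variable {β : S → S → S → Prop} {c : S} {e : HalfPoint (S × S) → S}

theorem base (h : Admissible β c e) : β c (e .bot) (e .top) :=
  let ⟨_, h, hR⟩ := h; (hR _ _ h).1

theorem first_bot (h : Admissible β c e) (i : S × S) : e (.piece i false .bot) = e .bot :=
  let ⟨_, h, hR⟩ := h; ((hR _ _ h).2 i).1

theorem glue (h : Admissible β c e) (i : S × S) :
    e (.piece i false .top) = e (.piece i true .bot) :=
  let ⟨_, h, hR⟩ := h; ((hR _ _ h).2 i).2.1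

theorem second_top (h : Admissible β c e) (i : S × S) : e (.piece i true .top) = e .top :=
  let ⟨_, h, hR⟩ := h; ((hR _ _ h).2 i).2.2.1

theorem restrict (h : Admissible β c e) (i : S × S) (p : Bool) :
    Admissible β (part c i p) (fun t => e (.piece i p t)) :=
  let ⟨R, h, hR⟩ := h; ⟨R, ((hR _ _ h).2 i).2.2.2 p, hR⟩

end Admissible

/-- The relation between the end values `p`, `q` of a monotone Lipschitz function on an interval of value `c`. -/
def Rise (c p q : S) : Prop := p ≤ q ∧ q ≤ p ⊔ c

/-- The relation between the end values `p`, `q` of an antitone Lipschitz function on an interval of value `c`. -/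
def Fall (c p q : S) : Prop := q ≤ p ∧ p ≤ q ⊔ c

variable {c : S} {e : HalfPoint (S × S) → S}

theorem rise_bounds (h : Admissible Rise c e) (x : HalfPoint (S × S)) :
    e .bot ≤ e x ∧ e x ≤ e .top ∧ e x ≤ e .bot ⊔ height c x := by
  induction x generalizing c e with
  | bot => exact ⟨le_rfl, h.base.1, le_sup_left⟩
  | top => exact ⟨h.base.1, le_rfl, h.base.2⟩
  | piece i p t ih =>
    have h0 := (h.restrict i false).base
    have h1 := (h.restrict i true).base
    have ht := ih (h.restrict i p)
    simp only [Rise, h.first_bot, h.second_top, h.glue] at h0 h1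
    cases p
    · simp only [h.first_bot, h.glue] at ht
      exact ⟨ht.1, ht.2.1.trans h1.1, ht.2.2⟩
    · simp only [h.second_top] at ht
      refine ⟨h0.1.trans ht.1, ht.2.1, ht.2.2.trans ?_⟩
      rw [height, ← sup_assoc]
      exact sup_le_sup_right h0.2 _

theorem fall_bounds (h : Admissible Fall c e) (x : HalfPoint (S × S)) :
    e .top ≤ e x ∧ e x ≤ e .bot ∧ e x ≤ e .top ⊔ depth c x := by
  induction x generalizing c e with
  | bot => exact ⟨h.base.1, le_rfl, h.base.2⟩
  | top => exact ⟨le_rfl, h.base.1, le_sup_left⟩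
  | piece i p t ih =>
    have h0 := (h.restrict i false).base
    have h1 := (h.restrict i true).base
    have ht := ih (h.restrict i p)
    simp only [Fall, h.first_bot, h.second_top, h.glue] at h0 h1
    cases p
    · simp only [h.first_bot, h.glue] at ht
      refine ⟨h1.1.trans ht.1, ht.2.1, ht.2.2.trans ?_⟩
      rw [depth, sup_comm (depth _ _), ← sup_assoc]
      exact sup_le_sup_right h1.2 _
    · simp only [h.second_top] at ht
      exact ⟨ht.1, ht.2.1.trans h0.1, ht.2.2⟩

theorem admissible_height (c : S) : Admissible Rise c (height c) := by
  refine ⟨fun c e => ∃ p : S, e = fun x => p ⊔ height c x, ⟨⊥, by simp⟩, ?_⟩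
  rintro c _ ⟨q, rfl⟩
  refine ⟨⟨by simp [height], by simp [height]⟩, fun i =>
    ⟨by simp [height], by simp [height], ?_, ?_⟩⟩
  · simp [height, part_sup_part]
  · rintro (_ | _)
    · exact ⟨q, rfl⟩
    · exact ⟨q ⊔ part c i false, by simp [height, sup_assoc]⟩

theorem admissible_depth (c : S) : Admissible Fall c (depth c) := by
  refine ⟨fun c e => ∃ p : S, e = fun x => depth c x ⊔ p, ⟨⊥, by simp⟩, ?_⟩
  rintro c _ ⟨q, rfl⟩
  refine ⟨⟨by simp [depth], by simp [depth, sup_comm]⟩, fun i =>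
    ⟨?_, by simp [depth], by simp [depth], ?_⟩⟩
  · simp [depth, part_sup_part]
  · rintro (_ | _)
    · exact ⟨part c i true ⊔ q, by simp [depth, sup_assoc]⟩
    · exact ⟨q, rfl⟩

theorem admissible_bot (c : S) : Admissible Fall c (fun _ => ⊥) :=
  ⟨fun _ e => e = fun _ => ⊥, rfl, by rintro c _ rfl; simp [Fall]⟩

theorem height_le (c : S) (x : HalfPoint (S × S)) : height c x ≤ c :=
  (rise_bounds (admissible_height c) x).2.1

theorem depth_le (c : S) (x : HalfPoint (S × S)) : depth c x ≤ c :=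
  (fall_bounds (admissible_depth c) x).2.1

/-! ### Interpolation in a distributive semilattice -/

/-- In a distributive semilattice two upper bounds for `x` and a lower bound for `x ⊔ e` can be
met simultaneously as soon as each upper bound is compatible with the lower one, as if `u ⊓ v`
existed. -/
theorem exists_le_two {T : Type u} [SemilatticeSup T] (hS : IsDistributiveSemilattice T)
    {l e u v : T} (hu : l ≤ u ⊔ e) (hv : l ≤ v ⊔ e) : ∃ x, x ≤ l ∧ x ≤ u ∧ x ≤ v ∧ l ≤ x ⊔ e := by
  obtain ⟨p, q, hp, hq, rfl⟩ := hS _ _ _ hu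
  obtain ⟨r, s, hr, hs, rfl⟩ := hS _ _ _ (le_sup_left.trans hv)
  exact ⟨r, le_sup_left.trans le_sup_left, le_sup_left.trans hp, hr,
    sup_le (sup_le le_sup_left (hs.trans le_sup_right)) (hq.trans le_sup_right)⟩

theorem exists_le_four {T : Type u} [SemilatticeSup T] (hS : IsDistributiveSemilattice T)
    {l e u₁ u₂ u₃ u₄ : T}
    (h₁ : l ≤ u₁ ⊔ e) (h₂ : l ≤ u₂ ⊔ e) (h₃ : l ≤ u₃ ⊔ e) (h₄ : l ≤ u₄ ⊔ e) :
    ∃ x, x ≤ u₁ ∧ x ≤ u₂ ∧ x ≤ u₃ ∧ x ≤ u₄ ∧ l ≤ x ⊔ e := by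
  obtain ⟨x, -, hx₁, hx₂, hx⟩ := exists_le_two hS h₁ h₂
  obtain ⟨y, -, hy₁, hy₂, hy⟩ := exists_le_two hS h₃ h₄
  obtain ⟨z, -, hz₁, hz₂, hz⟩ := exists_le_two hS hx hy
  exact ⟨z, hz₁.trans hx₁, hz₁.trans hx₂, hz₂.trans hy₁, hz₂.trans hy₂, hz⟩

/-- `r` continues the values `f`, `g` at the horizontal ends and `p`, `q` at the vertical ends of a
cross monotonically and in a Lipschitz way. The arms have values `a`, `b` and `a'`, `b'`. -/
def IsMidpoint (a b a' b' f g p q r : S) : Prop :=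
  Rise a f r ∧ Rise b r g ∧ Fall a' p r ∧ Fall b' r q

/-- A value as in `IsMidpoint`, of no significance if there is none. -/
noncomputable def midpoint (a b a' b' f g p q : S) : S :=
  Classical.epsilon (IsMidpoint a b a' b' f g p q)

/-- The hypotheses say that any two of the four end values are compatible with the length of the way
between them; this is enough for a value in the centre to exist. -/
theorem isMidpoint_midpoint (hS : IsDistributiveSemilattice S) {a b a' b' f g p q : S}
    (hfg : Rise (a ⊔ b) f g) (hpq : Fall (a' ⊔ b') p q)
    (hfp : f ≤ p) (hfq : f ≤ q ⊔ b') (hqg : q ≤ g) (hqf : q ≤ f ⊔ a)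
    (hgp : g ≤ p ⊔ b) (hgq : g ≤ q ⊔ (b ⊔ b')) (hpg : p ≤ g ⊔ a') (hpf : p ≤ f ⊔ (a ⊔ a')) :
    IsMidpoint a b a' b' f g p q (midpoint a b a' b' f g p q) := by
  refine Classical.epsilon_spec (p := IsMidpoint a b a' b' f g p q) ?_
  obtain ⟨hfg, hgf⟩ := hfg
  obtain ⟨hqp, hpq⟩ := hpq
  obtain ⟨x, hx₁, hx₂, hx₃, hx₄, hx⟩ := exists_le_four hS (l := g) (e := b) (u₁ := g)
    (u₂ := f ⊔ a) (u₃ := p) (u₄ := q ⊔ b') le_sup_left (by rwa [sup_assoc]) hgp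
    (by rwa [sup_assoc, sup_comm b'])
  obtain ⟨y, hy₁, hy₂, hy₃, hy₄, hy⟩ := exists_le_four hS (l := p) (e := a') (u₁ := g)
    (u₂ := f ⊔ a) (u₃ := p) (u₄ := q ⊔ b') hpg (by rwa [sup_assoc]) le_sup_left
    (by rwa [sup_assoc, sup_comm b'])
  -- `f` and `q` must lie below the solution, `x` and `y` serve the two Lipschitz lower bounds.
  refine ⟨f ⊔ q ⊔ x ⊔ y, ⟨?_, ?_⟩, ⟨?_, ?_⟩, ⟨?_, ?_⟩, ?_, ?_⟩
  · exact le_sup_left.trans (le_sup_left.trans le_sup_left)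
  · exact sup_le (sup_le (sup_le le_sup_left hqf) hx₂) hy₂
  · exact sup_le (sup_le (sup_le hfg hqg) hx₁) hy₁
  · exact hx.trans (sup_le_sup_right (le_sup_right.trans le_sup_left) _)
  · exact sup_le (sup_le (sup_le hfp hqp) hx₃) hy₃
  · exact hy.trans (sup_le_sup_right le_sup_right _)
  · exact le_sup_right.trans (le_sup_left.trans le_sup_left)
  · exact sup_le (sup_le (sup_le hfq le_sup_left) hx₄) hy₄

/-! ### Functions of two variables by bisection -/

/-- A function between `f` and `g` with end values `p` and `q`: the column over the point that
divides a horizontal interval into parts of values `a` and `b`, when the columns over the ends of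
that interval are `f` and `g`. The vertical interval has value `d`. -/
noncomputable def line (a b : S) :
    S → (HalfPoint (S × S) → S) → (HalfPoint (S × S) → S) → S → S → HalfPoint (S × S) → S
  | _, _, _, p, _, .bot => p
  | _, _, _, _, q, .top => q
  | d, f, g, p, q, .piece j false t =>
    line a b (part d j false) (fun s => f (.piece j false s)) (fun s => g (.piece j false s)) p
      (midpoint a b (part d j false) (part d j true) (f (.piece j false .top))
        (g (.piece j false .top)) p q) t
  | d, f, g, p, q, .piece j true t =>
    line a b (part d j true) (fun s => f (.piece j true s)) (fun s => g (.piece j true s))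
      (midpoint a b (part d j false) (part d j true) (f (.piece j false .top))
        (g (.piece j false .top)) p q) q t

/-- Conditions on the neighbouring columns and on the end values under which `line` interpolates. -/
structure LineData (a b d : S) (f g : HalfPoint (S × S) → S) (p q : S) : Prop where
  left : Admissible Fall d f
  right : Admissible Fall d g
  rise : ∀ y, Rise (a ⊔ b) (f y) (g y)
  first : Rise a (f .bot) p ∧ Rise b p (g .bot)
  last : Rise a (f .top) q ∧ Rise b q (g .top)
  fall : Fall d p q

theorem LineData.isMidpoint (hS : IsDistributiveSemilattice S) {a b d : S}
    {f g : HalfPoint (S × S) → S} {p q : S} (h : LineData a b d f g p q) (j : S × S) :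
    IsMidpoint a b (part d j false) (part d j true) (f (.piece j false .top))
      (g (.piece j false .top)) p q (midpoint a b (part d j false) (part d j true)
        (f (.piece j false .top)) (g (.piece j false .top)) p q) := by
  obtain ⟨⟨hp₁, hp₂⟩, hp₃, hp₄⟩ := h.first
  obtain ⟨⟨hq₁, hq₂⟩, hq₃, hq₄⟩ := h.last
  have hf₀ := (h.left.restrict j false).base
  have hf₁ := (h.left.restrict j true).base
  have hg₀ := (h.right.restrict j false).base
  have hg₁ := (h.right.restrict j true).base
  simp only [h.left.first_bot, h.right.first_bot, ← h.left.glue, ← h.right.glue,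
    h.left.second_top, h.right.second_top] at hf₀ hf₁ hg₀ hg₁
  refine isMidpoint_midpoint hS (h.rise _) (by rw [part_sup_part]; exact h.fall)
    (hf₀.1.trans hp₁) (hf₁.2.trans (sup_le_sup_right hq₁ _)) (hq₃.trans hg₁.1)
    (hq₂.trans (sup_le_sup_right hf₁.1 _)) (hg₀.1.trans hp₄) ?_
    (hp₃.trans hg₀.2) ?_
  · exact hg₁.2.trans (by rw [← sup_assoc]; exact sup_le_sup_right hq₄ _)
  · refine hp₂.trans ?_
    rw [sup_comm a, ← sup_assoc]; exact sup_le_sup_right hf₀.2 _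

theorem LineData.restrict (hS : IsDistributiveSemilattice S) {a b d : S}
    {f g : HalfPoint (S × S) → S} {p q : S} (h : LineData a b d f g p q) (j : S × S) :
    LineData a b (part d j false) (fun s => f (.piece j false s)) (fun s => g (.piece j false s)) p
      (midpoint a b (part d j false) (part d j true) (f (.piece j false .top))
        (g (.piece j false .top)) p q) ∧
    LineData a b (part d j true) (fun s => f (.piece j true s)) (fun s => g (.piece j true s))
      (midpoint a b (part d j false) (part d j true) (f (.piece j false .top))
        (g (.piece j false .top)) p q) q := by
  have hm := h.isMidpoint hS j
  refine ⟨⟨h.left.restrict j _, h.right.restrict j _, fun y => h.rise _, ?_, ⟨hm.1, hm.2.1⟩,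
    hm.2.2.1⟩, ⟨h.left.restrict j _, h.right.restrict j _, fun y => h.rise _, ?_, ?_, hm.2.2.2⟩⟩
  · simpa only [h.left.first_bot, h.right.first_bot] using h.first
  · simpa only [h.left.glue, h.right.glue] using (⟨hm.1, hm.2.1⟩ : _ ∧ _)
  · simpa only [h.left.second_top, h.right.second_top] using h.last

theorem LineData.admissible (hS : IsDistributiveSemilattice S) {a b d : S}
    {f g : HalfPoint (S × S) → S} {p q : S} (h : LineData a b d f g p q) :
    Admissible Fall d (line a b d f g p q) := by
  refine ⟨fun d e => ∃ f g p q, LineData a b d f g p q ∧ e = line a b d f g p q,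
    ⟨f, g, p, q, h, rfl⟩, ?_⟩
  rintro d _ ⟨f, g, p, q, h, rfl⟩
  refine ⟨h.fall, fun j => ⟨rfl, rfl, rfl, ?_⟩⟩
  rintro (_ | _)
  · exact ⟨_, _, _, _, (h.restrict hS j).1, rfl⟩
  · exact ⟨_, _, _, _, (h.restrict hS j).2, rfl⟩

theorem LineData.between (hS : IsDistributiveSemilattice S) {a b d : S}
    {f g : HalfPoint (S × S) → S} {p q : S} (h : LineData a b d f g p q)
    (y : HalfPoint (S × S)) :
    Rise a (f y) (line a b d f g p q y) ∧ Rise b (line a b d f g p q y) (g y) := by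
  induction y generalizing d f g p q with
  | bot => exact h.first
  | top => exact h.last
  | piece j r t ih =>
    cases r
    · exact ih (h.restrict hS j).1
    · exact ih (h.restrict hS j).2

/-- A function of two variables on a horizontal half of value `c` and a vertical half of value
`d`, with columns `f` and `g` over the ends. It is obtained by inserting columns between columns;
the bottom value of a new column is prescribed, and its top value is `⊥`. -/
noncomputable def sheet (d : S) : S → (HalfPoint (S × S) → S) → (HalfPoint (S × S) → S) →
    HalfPoint (S × S) → HalfPoint (S × S) → S
  | _, f, _, .bot => f
  | _, _, g, .top => g
  | c, f, g, .piece i false t => sheet d (part c i false) f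
      (line (part c i false) (part c i true) d f g (f .bot ⊔ part c i false) ⊥) t
  | c, f, g, .piece i true t => sheet d (part c i true)
      (line (part c i false) (part c i true) d f g (f .bot ⊔ part c i false) ⊥) g t

/-- Conditions on the end columns under which `sheet` is admissible in both variables. -/
structure SheetData (d c : S) (f g : HalfPoint (S × S) → S) : Prop where
  left : Admissible Fall d f
  right : Admissible Fall d g
  rise : ∀ y, Rise c (f y) (g y)
  bot : g .bot = f .bot ⊔ c
  left_top : f .top = ⊥
  right_top : g .top = ⊥

theorem SheetData.lineData {d c : S} {f g : HalfPoint (S × S) → S} (h : SheetData d c f g)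
    (i : S × S) : LineData (part c i false) (part c i true) d f g (f .bot ⊔ part c i false) ⊥ := by
  refine ⟨h.left, h.right, ?_, ?_, ?_, ?_⟩
  · simpa only [part_sup_part] using h.rise
  · rw [h.bot]
    refine ⟨⟨le_sup_left, le_rfl⟩, sup_le_sup_left (part_le _ _ _) _, ?_⟩
    rw [sup_assoc, part_sup_part]
  · simp [h.left_top, h.right_top, Rise]
  · refine ⟨bot_le, (sup_le_sup_left (part_le _ _ _) _).trans ?_⟩
    rw [← h.bot, ← h.right_top]
    exact h.right.base.2

theorem SheetData.restrict (hS : IsDistributiveSemilattice S) {d c : S}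
    {f g : HalfPoint (S × S) → S} (h : SheetData d c f g) (i : S × S) :
    SheetData d (part c i false) f
      (line (part c i false) (part c i true) d f g (f .bot ⊔ part c i false) ⊥) ∧
    SheetData d (part c i true)
      (line (part c i false) (part c i true) d f g (f .bot ⊔ part c i false) ⊥) g := by
  have hl := h.lineData i
  exact ⟨⟨h.left, hl.admissible hS, fun y => (hl.between hS y).1, rfl, h.left_top, rfl⟩,
    ⟨hl.admissible hS, h.right, fun y => (hl.between hS y).2,
      by rw [h.bot, line, sup_assoc, part_sup_part], rfl, h.right_top⟩⟩

theorem SheetData.fall (hS : IsDistributiveSemilattice S) {d c : S}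
    {f g : HalfPoint (S × S) → S} (h : SheetData d c f g) (x : HalfPoint (S × S)) :
    Admissible Fall d (sheet d c f g x) := by
  induction x generalizing c f g with
  | bot => exact h.left
  | top => exact h.right
  | piece i p t ih =>
    cases p
    · exact ih (h.restrict hS i).1
    · exact ih (h.restrict hS i).2

theorem SheetData.admissible_rise (hS : IsDistributiveSemilattice S) {d c : S}
    {f g : HalfPoint (S × S) → S} (h : SheetData d c f g) (y : HalfPoint (S × S)) :
    Admissible Rise c (fun x => sheet d c f g x y) := by
  refine ⟨fun c e => ∃ f g, SheetData d c f g ∧ e = fun x => sheet d c f g x y,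
    ⟨f, g, h, rfl⟩, ?_⟩
  rintro c _ ⟨f, g, h, rfl⟩
  refine ⟨h.rise y, fun i => ⟨rfl, rfl, rfl, ?_⟩⟩
  rintro (_ | _)
  · exact ⟨_, _, (h.restrict hS i).1, rfl⟩
  · exact ⟨_, _, (h.restrict hS i).2, rfl⟩

theorem sheet_bot {d c : S} {f g : HalfPoint (S × S) → S} (h : g .bot = f .bot ⊔ c)
    (x : HalfPoint (S × S)) : sheet d c f g x .bot = f .bot ⊔ height c x := by
  induction x generalizing c f g with
  | bot => simp [sheet, height]
  | top => simp [sheet, height, h]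
  | piece i p t ih =>
    cases p
    · rw [sheet, ih (by rw [line]), height]
    · rw [sheet, ih (by rw [h, line, sup_assoc, part_sup_part]), line, height, sup_assoc]

theorem sheet_top {d c : S} {f g : HalfPoint (S × S) → S} (hf : f .top = ⊥) (hg : g .top = ⊥)
    (x : HalfPoint (S × S)) : sheet d c f g x .top = ⊥ := by
  induction x generalizing c f g with
  | bot => exact hf
  | top => exact hg
  | piece i p t ih =>
    cases p
    · exact ih hf rfl
    · exact ih rfl hg

/-- The measure between points of different chains of an interval of value `c`, in terms of the
lower coordinate of the first point and the upper coordinate of the second: a substitute for the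
meet of `height c x` and `depth c y`. -/
noncomputable def cross (c : S) : HalfPoint (S × S) → HalfPoint (S × S) → S :=
  sheet c c (fun _ => ⊥) (depth c)

theorem sheetData_cross (c : S) : SheetData c c (fun _ => ⊥) (depth c) where
  left := admissible_bot c
  right := admissible_depth c
  rise y := ⟨bot_le, by simpa using depth_le c y⟩
  bot := by simp [depth]
  left_top := rfl
  right_top := rfl

@[simp] theorem cross_bot_left (c : S) (y : HalfPoint (S × S)) : cross c .bot y = ⊥ := rfl

@[simp] theorem cross_top_left (c : S) (y : HalfPoint (S × S)) : cross c .top y = depth c y := rfl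

@[simp] theorem cross_bot_right (c : S) (x : HalfPoint (S × S)) : cross c x .bot = height c x :=
  (sheet_bot (by simp [depth]) x).trans (by simp)

@[simp] theorem cross_top_right (c : S) (x : HalfPoint (S × S)) : cross c x .top = ⊥ :=
  sheet_top rfl rfl x

/-! ### The measure on points -/

section measure

variable {S : Type u} [SemilatticeSup S] [OrderBot S]

open Classical in
/-- The measure on points of an interval of value `c`. On one chain it adds up the values of the
pieces between the two points; in all other cases, the ends included, it is given by `cross`. -/
noncomputable def mu (c : S) : Point (S × S) → Point (S × S) → S
  | .piece i h p t, .piece j k q s =>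
    if i = j then
      match h, k with
      | false, true => ⊥
      | true, false => height c (.piece i p (lower t)) ⊔ depth c (.piece i q (upper s))
      | _, _ =>
        match p, q with
        | false, true => ⊥
        | true, false => height (part c i true) (lower t) ⊔ depth (part c i false) (upper s)
        | false, false => mu (part c i false) t s
        | true, true => mu (part c i true) t s
    else cross c (lower (.piece i h p t)) (upper (.piece j k q s))
  | x, y => cross c (lower x) (upper y)

/-- Two points are aligned when they are given as points of the same chain. The ends `bot` and `top`
are aligned with no point. -/
def Aligned {ι : Type u} : Point ι → Point ι → Prop
  | .piece i _ _ _, .piece j _ _ _ => i = j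
  | _, _ => False

theorem Aligned.symm {ι : Type u} {x y : Point ι} (h : Aligned x y) : Aligned y x := by
  cases x <;> cases y <;> simp_all [Aligned]

theorem Aligned.trans {ι : Type u} {x y z : Point ι} (h : Aligned x y) (h' : Aligned y z) :
    Aligned x z := by
  cases x <;> cases y <;> cases z <;> simp_all [Aligned]

theorem mu_of_not_aligned (c : S) {x y : Point (S × S)} (h : ¬ Aligned x y) :
    mu c x y = cross c (lower x) (upper y) := by
  cases x <;> cases y <;> simp_all [mu, Aligned]

@[simp] theorem mu_bot_left (c : S) (y : Point (S × S)) : mu c .bot y = ⊥ := by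
  rw [mu_of_not_aligned c (by simp [Aligned]), lower, cross_bot_left]

@[simp] theorem mu_top_right (c : S) (x : Point (S × S)) : mu c x .top = ⊥ := by
  rw [mu_of_not_aligned c (by cases x <;> simp [Aligned]), upper, cross_top_right]

@[simp] theorem mu_top_left (c : S) (y : Point (S × S)) : mu c .top y = depth c (upper y) := by
  rw [mu_of_not_aligned c (by simp [Aligned]), lower, cross_top_left]

@[simp] theorem mu_bot_right (c : S) (x : Point (S × S)) : mu c x .bot = height c (lower x) := by
  rw [mu_of_not_aligned c (by cases x <;> simp [Aligned]), upper, cross_bot_right]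

@[simp] theorem mu_half_lt (c : S) (i : S × S) (p q : Bool) (t s : Point (S × S)) :
    mu c (.piece i false p t) (.piece i true q s) = ⊥ := by simp [mu]

@[simp] theorem mu_half_gt (c : S) (i : S × S) (p q : Bool) (t s : Point (S × S)) :
    mu c (.piece i true p t) (.piece i false q s) =
      height c (.piece i p (lower t)) ⊔ depth c (.piece i q (upper s)) := by simp [mu]

@[simp] theorem mu_piece_lt (c : S) (i : S × S) (h : Bool) (t s : Point (S × S)) :
    mu c (.piece i h false t) (.piece i h true s) = ⊥ := by cases h <;> simp [mu]

@[simp] theorem mu_piece_gt (c : S) (i : S × S) (h : Bool) (t s : Point (S × S)) :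
    mu c (.piece i h true t) (.piece i h false s) =
      height (part c i true) (lower t) ⊔ depth (part c i false) (upper s) := by
  cases h <;> simp [mu]

@[simp] theorem mu_piece (c : S) (i : S × S) (h p : Bool) (t s : Point (S × S)) :
    mu c (.piece i h p t) (.piece i h p s) = mu (part c i p) t s := by
  cases h <;> cases p <;> simp [mu]

theorem mu_half_congr (c : S) (i : S × S) (h k p q : Bool) (t s : Point (S × S)) :
    mu c (.piece i h p t) (.piece i h q s) = mu c (.piece i k p t) (.piece i k q s) := by
  cases p <;> cases q <;> simp

theorem rise_top_le {c : S} {e : HalfPoint (S × S) → S} (he : Admissible Rise c e)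
    (y : Point (S × S)) : e .top ≤ depth c (upper y) ⊔ e (lower y) := by
  rcases upper_eq_bot_or_lower_eq_top y with h | h
  · rw [h, depth, sup_comm]
    exact he.base.2.trans (sup_le_sup_right (rise_bounds he _).1 _)
  · rw [h]; exact le_sup_right

theorem fall_bot_le {c : S} {f : HalfPoint (S × S) → S} (hf : Admissible Fall c f)
    (x : Point (S × S)) : f .bot ≤ f (upper x) ⊔ height c (lower x) := by
  rcases upper_eq_bot_or_lower_eq_top x with h | h
  · rw [h]; exact le_sup_left
  · rw [h, height]
    exact hf.base.2.trans (sup_le_sup_right (fall_bounds hf _).1 _)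

/-- Locally Lipschitz functions are Lipschitz for the measure. For points of different chains this
is where doubling is used: either `y` has lower coordinate `top`, where `e` is largest, or it has
upper coordinate `bot`, and then `mu c x y` is the whole height of `x`. -/
theorem le_mu_sup_of_rise {c : S} {e : HalfPoint (S × S) → S} (he : Admissible Rise c e)
    (x y : Point (S × S)) : e (lower x) ≤ mu c x y ⊔ e (lower y) := by
  induction x generalizing c e y with
  | bot => exact (rise_bounds he _).1.trans le_sup_right
  | top => simpa [lower] using rise_top_le he y
  | piece i h p t ih =>
    rcases upper_eq_bot_or_lower_eq_top y with hy | hy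
    swap
    · rw [hy]; exact (rise_bounds he _).2.1.trans le_sup_right
    by_cases ha : Aligned (.piece i h p t) y
    swap
    · rw [mu_of_not_aligned c ha, hy, cross_bot_right, sup_comm]
      exact (rise_bounds he _).2.2.trans (sup_le_sup_right (rise_bounds he _).1 _)
    rcases y with _ | _ | ⟨j, k, q, s⟩
    · exact ha.elim
    · exact ha.elim
    obtain rfl : i = j := ha
    have h0 := fun z => rise_bounds (he.restrict i false) z
    have h1 := fun z => rise_bounds (he.restrict i true) z
    have e0 := rise_top_le (he.restrict i false) s
    have e1 := rise_top_le (he.restrict i true) s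
    have g0 := (he.restrict i false).base
    have g1 := (he.restrict i true).base
    simp only [Rise, he.first_bot, he.second_top, he.glue] at h0 h1 e0 e1 g0 g1
    rcases k with _ | _
    swap
    · rw [show lower (.piece i true q s) = .top from rfl]
      exact (rise_bounds he _).2.1.trans le_sup_right
    rcases h with _ | _
    · rcases p with _ | _ <;> rcases q with _ | _
      · simpa [lower] using ih (he.restrict i false) s
      · simpa [lower] using (h0 _).2.1.trans (h1 _).1
      · simp only [lower, mu_piece_gt]
        refine (h1 _).2.2.trans ?_
        rw [sup_comm, sup_assoc]
        exact sup_le_sup_left e0 _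
      · simpa [lower] using ih (he.restrict i true) s
    · simp only [lower, mu_half_gt]
      rw [sup_assoc]
      refine le_sup_of_le_right ?_
      rcases q with _ | _ <;> simp only [depth]
      · refine g1.2.trans ?_
        rw [sup_comm, sup_right_comm, sup_comm _ (part c i true)]
        exact sup_le_sup_left e0 _
      · exact e1

/-- The dual of `le_mu_sup_of_rise`. -/
theorem le_sup_mu_of_fall {c : S} {f : HalfPoint (S × S) → S} (hf : Admissible Fall c f)
    (y z : Point (S × S)) : f (upper z) ≤ f (upper y) ⊔ mu c y z := by
  induction z generalizing c f y with
  | top => exact (fall_bounds hf _).1.trans le_sup_left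
  | bot => simpa [upper] using fall_bot_le hf y
  | piece i h p t ih =>
    rcases upper_eq_bot_or_lower_eq_top y with hy | hy
    · rw [hy]; exact (fall_bounds hf _).2.1.trans le_sup_left
    by_cases ha : Aligned y (.piece i h p t)
    swap
    · rw [mu_of_not_aligned c ha, hy, cross_top_left]
      exact (fall_bounds hf _).2.2.trans (sup_le_sup_right (fall_bounds hf _).1 _)
    rcases y with _ | _ | ⟨j, k, q, s⟩
    · exact ha.elim
    · exact ha.elim
    obtain rfl : j = i := ha
    have h0 := fun z => fall_bounds (hf.restrict j false) z
    have h1 := fun z => fall_bounds (hf.restrict j true) z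
    have e0 := fall_bot_le (hf.restrict j false) s
    have e1 := fall_bot_le (hf.restrict j true) s
    have g0 := (hf.restrict j false).base
    have g1 := (hf.restrict j true).base
    simp only [Fall, hf.first_bot, hf.second_top, hf.glue] at h0 h1 e0 e1 g0 g1
    rcases k with _ | _
    · rw [show upper (.piece j false q s) = .bot from rfl]
      exact (fall_bounds hf _).2.1.trans le_sup_left
    rcases h with _ | _
    swap
    · rcases p with _ | _ <;> rcases q with _ | _
      · simpa [upper] using ih (hf.restrict j false) s
      · simp only [upper, mu_piece_gt]
        refine (h0 _).2.2.trans ?_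
        rw [← sup_assoc]
        exact sup_le_sup_right e1 _
      · simpa [upper] using (h1 _).2.1.trans (h0 _).1
      · simpa [upper] using ih (hf.restrict j true) s
    · simp only [upper, mu_half_gt]
      rw [← sup_assoc]
      refine le_sup_of_le_left ?_
      rcases q with _ | _ <;> simp only [height]
      · exact e0
      · refine g0.2.trans ?_
        rw [sup_comm (part c j false), ← sup_assoc]
        exact sup_le_sup_right e1 _

theorem height_le_mu_sup (c : S) (x y : Point (S × S)) :
    height c (lower x) ≤ mu c x y ⊔ height c (lower y) :=
  le_mu_sup_of_rise (admissible_height c) x y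

theorem depth_le_sup_mu (c : S) (y z : Point (S × S)) :
    depth c (upper z) ≤ depth c (upper y) ⊔ mu c y z :=
  le_sup_mu_of_fall (admissible_depth c) y z

theorem cross_le (hS : IsDistributiveSemilattice S) (c : S) (x y : HalfPoint (S × S)) :
    cross c x y ≤ height c x ∧ cross c x y ≤ depth c y := by
  rw [← cross_bot_right, ← cross_top_left]
  exact ⟨(fall_bounds ((sheetData_cross c).fall hS x) y).2.1,
    (rise_bounds ((sheetData_cross c).admissible_rise hS y) x).2.1⟩

theorem mu_le (hS : IsDistributiveSemilattice S) (c : S) (x y : Point (S × S)) :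
    mu c x y ≤ height c (lower x) ∧ mu c x y ≤ depth c (upper y) := by
  induction x generalizing c y with
  | bot => simp
  | top => simpa [lower, height] using depth_le c _
  | piece i h p t ih =>
    by_cases ha : Aligned (.piece i h p t) y
    swap
    · rw [mu_of_not_aligned c ha]
      exact cross_le hS c _ _
    rcases y with _ | _ | ⟨j, k, q, s⟩
    · exact ha.elim
    · exact ha.elim
    obtain rfl : i = j := ha
    have hs := part_sup_part c i
    have hp := part_le c i
    have hh0 := height_le (part c i false) (lower t)
    have hh1 := height_le (part c i true) (lower t)
    have hd0 := depth_le (part c i false) (upper s)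
    have hd1 := depth_le (part c i true) (upper s)
    have i0 := ih (part c i false) s
    have i1 := ih (part c i true) s
    have hc := height_le c (.piece i p (lower t))
    have dc := depth_le c (.piece i q (upper s))
    have j0 := (i0.1.trans hh0).trans (hp false)
    have j1 := (i1.1.trans hh1).trans (hp true)
    rcases h with _ | _ <;> rcases k with _ | _
    · rcases p with _ | _ <;> rcases q with _ | _
      · simp [lower, upper, height, depth, i0.1, j0]
      · simp
      · simp [lower, upper, height, depth, hh1.trans (hp _), hd0.trans (hp _),
          le_sup_of_le_left hd0]
      · simp [lower, upper, height, depth, le_sup_of_le_right i1.1, j1]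
    · simp
    · simpa [lower, upper, height, depth] using ⟨hc, dc⟩
    · rcases p with _ | _ <;> rcases q with _ | _
      · simp [lower, upper, height, depth, j0, le_sup_of_le_left i0.2]
      · simp
      · simp [lower, upper, height, depth, hh1.trans (hp _), hd0.trans (hp _),
          le_sup_of_le_right hh1]
      · simp [lower, upper, height, depth, i1.2, j1]

theorem mu_triangle (hS : IsDistributiveSemilattice S) (c : S) (x y z : Point (S × S)) :
    mu c x z ≤ mu c x y ⊔ mu c y z := by
  induction x generalizing c y z with
  | bot => simp
  | top => simpa using depth_le_sup_mu c y z
  | piece i h p t ih =>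
    by_cases hxz : Aligned (.piece i h p t) z
    swap
    -- The left side is a value of `cross`, which is Lipschitz in each variable.
    · rw [mu_of_not_aligned c hxz]
      by_cases hyz : Aligned y z
      · have hxy : ¬ Aligned (.piece i h p t) y := by
          cases y <;> cases z <;> simp_all [Aligned]
        rw [mu_of_not_aligned c hxy]
        exact le_sup_mu_of_fall ((sheetData_cross c).fall hS _) y z
      · rw [mu_of_not_aligned c hyz]
        exact le_mu_sup_of_rise ((sheetData_cross c).admissible_rise hS _) _ y
    by_cases hxy : Aligned (.piece i h p t) y
    swap
    · have hyz : ¬ Aligned y z := fun hyz => hxy (hxz.trans hyz.symm)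
      rw [mu_of_not_aligned c hxy, mu_of_not_aligned c hyz]
      -- A point of another chain sees `x` or `z` at one end of the interval, thanks to doubling.
      rcases upper_eq_bot_or_lower_eq_top y with hy | hy
      · rw [hy, cross_bot_right]
        exact le_sup_of_le_left (mu_le hS c _ _).1
      · rw [hy, cross_top_left]
        exact le_sup_of_le_right (mu_le hS c _ _).2
    rcases y with _ | _ | ⟨j, k, q, s⟩
    · exact hxy.elim
    · exact hxy.elim
    rcases z with _ | _ | ⟨l, m, r, w⟩
    · exact hxz.elim
    · exact hxz.elim
    obtain rfl : i = j := hxy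
    obtain rfl : i = l := hxz
    -- The same triangle inequality inside one half of the chain.
    have half : ∀ h, mu c (.piece i h p t) (.piece i h r w) ≤
        mu c (.piece i h p t) (.piece i h q s) ⊔ mu c (.piece i h q s) (.piece i h r w) := by
      intro h
      have h1 := height_le_mu_sup (part c i true) t s
      have d0 := depth_le_sup_mu (part c i false) s w
      have m0 := (mu_le hS (part c i false) t w).2
      have m1 := (mu_le hS (part c i true) t w).1
      rcases p with _ | _ <;> rcases q with _ | _ <;> rcases r with _ | _ <;>
        try simp only [mu_piece, mu_piece_lt, mu_piece_gt, bot_le, bot_sup_eq, sup_bot_eq]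
      · exact ih _ _ _
      · exact le_sup_of_le_right m0
      · rw [sup_assoc]
        exact sup_le_sup_left d0 _
      · exact le_sup_of_le_left m1
      · rw [← sup_assoc]
        exact sup_le_sup_right h1 _
      · exact ih _ _ _
    -- Heights are read off in the lower half and depths in the upper half, so both are stated there
    -- and carried over to the half of `x`.
    have hx := height_le_mu_sup c (.piece i false p t) (.piece i false q s)
    have dz := depth_le_sup_mu c (.piece i true q s) (.piece i true r w)
    have mlo := (mu_le hS c (.piece i false p t) (.piece i false r w)).1
    have mhi := (mu_le hS c (.piece i true p t) (.piece i true r w)).2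
    rw [mu_half_congr c i false h] at hx mlo
    rw [mu_half_congr c i true h] at dz mhi
    rcases h with _ | _ <;> rcases k with _ | _ <;> rcases m with _ | _ <;>
        try simp only [mu_half_lt, mu_half_gt, bot_le, bot_sup_eq, sup_bot_eq]
    · exact half false
    · exact le_sup_of_le_right mhi
    · rw [sup_assoc, mu_half_congr c i false true]
      exact sup_le_sup_left dz _
    · exact le_sup_of_le_left mlo
    · rw [← sup_assoc]
      exact sup_le_sup_right hx _
    · exact half true

end measure

/-! ### The order on points -/

section order

variable {ι : Type u}

/-- The position of a piece among the four pieces of its chain. -/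
def pos (h p : Bool) : ℕ := 2 * h.toNat + p.toNat

theorem pos_le (h p : Bool) : pos h p ≤ 3 := by
  cases h <;> cases p <;> simp [pos]

theorem pos_inj {h p k q : Bool} : pos h p = pos k q ↔ h = k ∧ p = q := by
  cases h <;> cases p <;> cases k <;> cases q <;> simp [pos]

/-- The points representing the lower end of the interval. -/
def AtBot : Point ι → Prop
  | .bot => True
  | .top => False
  | .piece _ h p t => pos h p = 0 ∧ AtBot t

/-- The points representing the upper end of the interval. -/
def AtTop : Point ι → Prop
  | .bot => False
  | .top => True
  | .piece _ h p t => pos h p = 3 ∧ AtTop t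

/-- The preorder on points: different chains are comparable only at the ends of the interval, and on
one chain the pieces follow each other, the end of a piece being equivalent to the beginning of the
next. -/
def le : Point ι → Point ι → Prop
  | .piece i h p t, .piece j k q s =>
    AtBot (.piece i h p t) ∨ AtTop (.piece j k q s) ∨
    (i = j ∧ (pos h p < pos k q ∨ (pos h p = pos k q ∧ le t s) ∨
      (pos h p = pos k q + 1 ∧ AtBot t ∧ AtTop s)))
  | x, y => AtBot x ∨ AtTop y

theorem atBot_bot : AtBot (.bot : Point ι) := by simp [AtBot]

theorem atTop_top : AtTop (.top : Point ι) := by simp [AtTop]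

theorem not_atTop_of_atBot {x : Point ι} (h : AtBot x) : ¬ AtTop x := by
  cases x <;> simp_all [AtBot, AtTop]

theorem le_of_atBot {x : Point ι} (h : AtBot x) (y : Point ι) : le x y := by
  cases x <;> cases y <;> simp [le, h]

theorem le_of_atTop {y : Point ι} (h : AtTop y) (x : Point ι) : le x y := by
  cases x <;> cases y <;> simp [le, h]

theorem le_cases {x y : Point ι} (h : le x y) : AtBot x ∨ AtTop y ∨ Aligned x y := by
  cases x <;> cases y <;> simp [le, Aligned] at h ⊢ <;> tauto

theorem le_bot_iff {x : Point ι} : le x .bot ↔ AtBot x := by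
  cases x <;> simp [le, AtTop]

theorem top_le_iff {y : Point ι} : le .top y ↔ AtTop y := by
  cases y <;> simp [le, AtBot]

/-- On a single chain the order is that of the four pieces, with consecutive ends identified. -/
theorem le_piece_iff {i : ι} {h p k q : Bool} {t s : Point ι} :
    le (.piece i h p t) (.piece i k q s) ↔ pos h p < pos k q ∨ (pos h p = pos k q ∧ le t s) ∨
      (pos h p = pos k q + 1 ∧ AtBot t ∧ AtTop s) := by
  have h1 := pos_le h p
  have h2 := pos_le k q
  have h3 := fun h => @le_of_atBot _ t h s
  have h4 := fun h => @le_of_atTop _ s h t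
  simp only [le, AtBot, AtTop, true_and]
  grind

theorem atBot_of_le {x y : Point ι} (h : le x y) (hy : AtBot y) : AtBot x := by
  induction x generalizing y with
  | bot => exact atBot_bot
  | top => exact (not_atTop_of_atBot hy (top_le_iff.1 h)).elim
  | piece i h p t ih =>
    rcases le_cases h with h' | h' | h'
    · exact h'
    · exact (not_atTop_of_atBot hy h').elim
    rcases y with _ | _ | ⟨j, k, q, s⟩
    · exact h'.elim
    · exact h'.elim
    obtain rfl : i = j := h'
    rw [le_piece_iff] at h
    have := @ih s
    have := @not_atTop_of_atBot _ s
    simp only [AtBot] at hy ⊢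
    grind

theorem atTop_of_le {x y : Point ι} (h : le x y) (hx : AtTop x) : AtTop y := by
  induction x generalizing y with
  | bot => simp [AtTop] at hx
  | top => exact top_le_iff.1 h
  | piece i h p t ih =>
    rcases le_cases h with h' | h' | h'
    · exact (not_atTop_of_atBot h' hx).elim
    · exact h'
    rcases y with _ | _ | ⟨j, k, q, s⟩
    · exact h'.elim
    · exact h'.elim
    obtain rfl : i = j := h'
    rw [le_piece_iff] at h
    have := @ih s
    have := @not_atTop_of_atBot _ t
    have := pos_le k q
    simp only [AtTop] at hx ⊢
    grind

theorem le_refl (x : Point ι) : le x x := by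
  induction x with
  | bot => exact le_of_atBot atBot_bot _
  | top => exact le_of_atTop atTop_top _
  | piece i h p t ih => exact le_piece_iff.2 (.inr (.inl ⟨rfl, ih⟩))

theorem le_trans {x y z : Point ι} (hxy : le x y) (hyz : le y z) : le x z := by
  induction x generalizing y z with
  | bot => exact le_of_atBot atBot_bot _
  | top => exact le_of_atTop (atTop_of_le hyz (top_le_iff.1 hxy)) _
  | piece i h p t ih =>
    rcases le_cases hxy with hx | hy | ha
    · exact le_of_atBot hx _
    · exact le_of_atTop (atTop_of_le hyz hy) _
    rcases le_cases hyz with hy | hz | hb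
    · exact le_of_atBot (atBot_of_le hxy hy) _
    · exact le_of_atTop hz _
    rcases y with _ | _ | ⟨j, k, q, s⟩
    · exact ha.elim
    · exact ha.elim
    rcases z with _ | _ | ⟨l, m, r, w⟩
    · exact hb.elim
    · exact hb.elim
    obtain rfl : i = j := ha
    obtain rfl : i = l := hb
    rw [le_piece_iff] at hxy hyz ⊢
    have := @not_atTop_of_atBot _ s
    have := @atBot_of_le _ t s
    have := @atTop_of_le _ s w
    have := fun h => @le_of_atBot _ t h w
    have := fun h => @le_of_atTop _ w h t
    have := @ih s w
    clear ih
    grind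

open Classical in
/-- A greatest lower bound of two points; it is unique only up to equivalence. -/
noncomputable def inf : Point ι → Point ι → Point ι
  | .piece i h p t, .piece j k q s =>
    if i = j then
      if pos h p = pos k q then .piece i h p (inf t s)
      else if pos h p < pos k q then .piece i h p t
      else .piece j k q s
    else if AtTop (.piece i h p t) then .piece j k q s
    else if AtTop (.piece j k q s) then .piece i h p t
    else .bot
  | .top, y => y
  | x, .top => x
  | _, _ => .bot

open Classical in
/-- A least upper bound of two points; it is unique only up to equivalence. -/
noncomputable def sup : Point ι → Point ι → Point ι
  | .piece i h p t, .piece j k q s =>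
    if i = j then
      if pos h p = pos k q then .piece i h p (sup t s)
      else if pos h p < pos k q then .piece j k q s
      else .piece i h p t
    else if AtBot (.piece i h p t) then .piece j k q s
    else if AtBot (.piece j k q s) then .piece i h p t
    else .top
  | .bot, y => y
  | x, .bot => x
  | _, _ => .top

theorem inf_le (x y : Point ι) : le (inf x y) x ∧ le (inf x y) y := by
  induction x generalizing y with
  | bot => cases y <;> simp only [inf] <;> exact ⟨le_of_atBot atBot_bot _, le_of_atBot atBot_bot _⟩
  | top => exact ⟨le_of_atTop atTop_top _, by simpa only [inf] using le_refl y⟩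
  | piece i h p t ih =>
    rcases y with _ | _ | ⟨j, k, q, s⟩
    · simp only [inf]; exact ⟨le_of_atBot atBot_bot _, le_of_atBot atBot_bot _⟩
    · simp only [inf]; exact ⟨le_refl _, le_of_atTop atTop_top _⟩
    simp only [inf]
    split_ifs with h1 h2 h3 h4 h5
    · subst h1
      simp only [le_piece_iff, h2, true_and]
      exact ⟨.inr (.inl (ih s).1), .inr (.inl (ih s).2)⟩
    · subst h1
      exact ⟨le_refl _, le_piece_iff.2 (.inl h3)⟩
    · subst h1
      exact ⟨le_piece_iff.2 (.inl (by omega)), le_refl _⟩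
    · exact ⟨le_of_atTop h4 _, le_refl _⟩
    · exact ⟨le_refl _, le_of_atTop h5 _⟩
    · exact ⟨le_of_atBot atBot_bot _, le_of_atBot atBot_bot _⟩

theorem le_sup (x y : Point ι) : le x (sup x y) ∧ le y (sup x y) := by
  induction x generalizing y with
  | bot => exact ⟨le_of_atBot atBot_bot _, by simpa only [sup] using le_refl y⟩
  | top => cases y <;> simp only [sup] <;> exact ⟨le_of_atTop atTop_top _, le_of_atTop atTop_top _⟩
  | piece i h p t ih =>
    rcases y with _ | _ | ⟨j, k, q, s⟩
    · simp only [sup]; exact ⟨le_refl _, le_of_atBot atBot_bot _⟩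
    · simp only [sup]; exact ⟨le_of_atTop atTop_top _, le_of_atTop atTop_top _⟩
    simp only [sup]
    split_ifs with h1 h2 h3 h4 h5
    · subst h1
      simp only [le_piece_iff, h2, true_and]
      exact ⟨.inr (.inl (ih s).1), .inr (.inl (ih s).2)⟩
    · subst h1
      exact ⟨le_piece_iff.2 (.inl h3), le_refl _⟩
    · subst h1
      exact ⟨le_refl _, le_piece_iff.2 (.inl (by omega))⟩
    · exact ⟨le_of_atBot h4 _, le_refl _⟩
    · exact ⟨le_refl _, le_of_atBot h5 _⟩
    · exact ⟨le_of_atTop atTop_top _, le_of_atTop atTop_top _⟩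

theorem le_inf {x y z : Point ι} (hx : le z x) (hy : le z y) : le z (inf x y) := by
  induction x generalizing y z with
  | bot => exact le_of_atBot (le_bot_iff.1 hx) _
  | top => simpa only [inf] using hy
  | piece i h p t ih =>
    by_cases hz : AtBot z
    · exact le_of_atBot hz _
    rcases y with _ | _ | ⟨j, k, q, s⟩
    · exact le_of_atBot (le_bot_iff.1 hy) _
    · simpa only [inf] using hx
    simp only [inf]
    split_ifs with h1 h2 h3 h4 h5
    · subst h1
      have kt : AtTop t → AtTop s → AtTop (inf t s) := fun ht hs =>
        top_le_iff.1 (ih (top_le_iff.2 ht) (top_le_iff.2 hs))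
      rcases z with _ | _ | ⟨l, m, r, w⟩
      · exact le_of_atBot atBot_bot _
      · simp only [top_le_iff, AtTop] at hx hy ⊢
        exact ⟨hx.1, kt hx.2 hy.2⟩
      · have kw : le w t → le w s → le w (inf t s) := ih
        have lt := fun h => @le_of_atTop _ t h w
        have ls := fun h => @le_of_atTop _ s h w
        have := pos_le m r
        simp only [le, hz, false_or, AtTop] at hx hy ⊢
        clear ih
        grind
    · exact hx
    · exact hy
    · exact hy
    · exact hx
    · rcases le_cases hx with h | h | h
      · exact (hz h).elim
      · exact (h4 h).elim
      rcases le_cases hy with h' | h' | h'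
      · exact (hz h').elim
      · exact (h5 h').elim
      exact (h1 (h.symm.trans h')).elim

theorem sup_le {x y z : Point ι} (hx : le x z) (hy : le y z) : le (sup x y) z := by
  induction x generalizing y z with
  | top => exact le_of_atTop (top_le_iff.1 hx) _
  | bot => simpa only [sup] using hy
  | piece i h p t ih =>
    by_cases hz : AtTop z
    · exact le_of_atTop hz _
    rcases y with _ | _ | ⟨j, k, q, s⟩
    · simpa only [sup] using hx
    · exact le_of_atTop (top_le_iff.1 hy) _
    simp only [sup]
    split_ifs with h1 h2 h3 h4 h5
    · subst h1
      have kt : AtBot t → AtBot s → AtBot (sup t s) := fun ht hs =>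
        le_bot_iff.1 (ih (le_bot_iff.2 ht) (le_bot_iff.2 hs))
      rcases z with _ | _ | ⟨l, m, r, w⟩
      · simp only [le_bot_iff, AtBot] at hx hy ⊢
        exact ⟨hx.1, kt hx.2 hy.2⟩
      · exact le_of_atTop atTop_top _
      · have kw : le t w → le s w → le (sup t s) w := ih
        have lt := fun h => @le_of_atBot _ t h w
        have ls := fun h => @le_of_atBot _ s h w
        have := pos_le m r
        simp only [le, hz, false_or, AtBot] at hx hy ⊢
        clear ih
        grind
    · exact hy
    · exact hx
    · exact hy
    · exact hx
    · rcases le_cases hx with h | h | h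
      · exact (h4 h).elim
      · exact (hz h).elim
      rcases le_cases hy with h' | h' | h'
      · exact (h5 h').elim
      · exact (hz h').elim
      exact (h1 (h.trans h'.symm)).elim

instance : Preorder (Point ι) where
  le := le
  le_refl := le_refl
  le_trans _ _ _ := le_trans

end order

/-! ### The measure and the order -/

section measureOrder

variable {S : Type u} [SemilatticeSup S] [OrderBot S]

theorem height_eq_bot {x : Point (S × S)} (h : AtBot x) (c : S) : height c (lower x) = ⊥ := by
  induction x generalizing c with
  | bot => rfl
  | top => simp [AtBot] at h
  | piece i k p t ih =>
    cases k <;> cases p <;> simp_all [AtBot, pos, lower, height]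

theorem depth_eq_bot {x : Point (S × S)} (h : AtTop x) (c : S) : depth c (upper x) = ⊥ := by
  induction x generalizing c with
  | bot => simp [AtTop] at h
  | top => rfl
  | piece i k p t ih =>
    cases k <;> cases p <;> simp_all [AtTop, pos, upper, depth]

theorem atBot_of_height_eq_bot {c : S} (hc : c ≠ ⊥) {x : Point (S × S)}
    (h : height c (lower x) = ⊥) : AtBot x := by
  induction x generalizing c with
  | bot => exact atBot_bot
  | top => exact (hc h).elim
  | piece i k p t ih =>
    have := part_ne_bot hc i
    have := @ih (part c i p) (this p)
    cases k <;> cases p <;> simp_all [AtBot, pos, lower, height]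

theorem atTop_of_depth_eq_bot {c : S} (hc : c ≠ ⊥) {x : Point (S × S)}
    (h : depth c (upper x) = ⊥) : AtTop x := by
  induction x generalizing c with
  | bot => exact (hc h).elim
  | top => exact atTop_top
  | piece i k p t ih =>
    have := part_ne_bot hc i
    have := @ih (part c i p) (this p)
    cases k <;> cases p <;> simp_all [AtTop, pos, upper, depth]

theorem mu_eq_bot_of_le (hS : IsDistributiveSemilattice S) (c : S) {x y : Point (S × S)}
    (h : le x y) : mu c x y = ⊥ := by
  induction x generalizing c y with
  | bot => simp
  | top => simpa using depth_eq_bot (top_le_iff.1 h) c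
  | piece i k p t ih =>
    rcases le_cases h with hx | hy | ha
    · exact bot_unique ((mu_le hS c _ _).1.trans_eq (height_eq_bot hx c))
    · exact bot_unique ((mu_le hS c _ _).2.trans_eq (depth_eq_bot hy c))
    rcases y with _ | _ | ⟨j, l, q, s⟩
    · exact ha.elim
    · exact ha.elim
    obtain rfl : i = j := ha
    rw [le_piece_iff] at h
    have := @ih (part c i p) s
    have := @height_eq_bot S _ _ t
    have := @depth_eq_bot S _ _ s
    cases k <;> cases p <;> cases l <;> cases q <;> simp_all [pos, height, depth]

theorem le_of_mu_eq_bot {c : S} (hc : c ≠ ⊥)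
    {x y : Point (S × S)} (h : le x y) (h0 : mu c y x = ⊥) : le y x := by
  induction x generalizing c y with
  | bot => exact le_of_atBot (atBot_of_height_eq_bot hc (by simpa using h0)) _
  | top => exact le_of_atTop atTop_top _
  | piece i k p t ih =>
    rcases le_cases h with hx | hy | ha
    · refine le_of_atBot (atBot_of_height_eq_bot hc ?_) _
      have := height_le_mu_sup c y (.piece i k p t)
      rwa [h0, height_eq_bot hx, sup_bot_eq, _root_.le_bot_iff] at this
    · refine le_of_atTop (atTop_of_depth_eq_bot hc ?_) _
      have := depth_le_sup_mu c y (.piece i k p t)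
      rwa [h0, depth_eq_bot hy, sup_bot_eq, _root_.le_bot_iff] at this
    rcases y with _ | _ | ⟨j, l, q, s⟩
    · exact ha.elim
    · exact ha.elim
    obtain rfl : i = j := ha
    rw [le_piece_iff] at h ⊢
    have hp := part_ne_bot hc i
    have := @ih (part c i p) (hp p) s
    have := @atBot_of_height_eq_bot S _ _ _ (hp q) s
    have := @atTop_of_depth_eq_bot S _ _ _ (hp p) t
    cases k <;> cases p <;> cases l <;> cases q <;> simp_all [pos, height, depth]

/-! ### Refinement of chains -/

/-- The pairs `x ≤ y` with `μ(y, x)` below `a` or below `b`, in an interval of value `c`. -/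
def Step (c a b : S) (x y : Point (S × S)) : Prop :=
  le x y ∧ (mu c y x ≤ a ∨ mu c y x ≤ b)

/-- Finite sequences of such comparable pairs. -/
abbrev Path (c a b : S) : Point (S × S) → Point (S × S) → Prop :=
  Relation.ReflTransGen (Step c a b)

variable {a b c : S}

theorem Path.of_equiv (hS : IsDistributiveSemilattice S) {x y : Point (S × S)} (h : le x y)
    (h' : le y x) : Path c a b x y :=
  .single ⟨h, .inl (by rw [mu_eq_bot_of_le hS c h']; exact bot_le)⟩

theorem Path.piece {i : S × S} {p : Bool} {t s : Point (S × S)} (h : Path (part c i p) a b t s)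
    (k : Bool) : Path c a b (.piece i k p t) (.piece i k p s) :=
  h.lift _ fun x y hxy => ⟨le_piece_iff.2 (.inr (.inl ⟨rfl, hxy.1⟩)), by simpa using hxy.2⟩

theorem Path.bot_first (hS : IsDistributiveSemilattice S) (i : S × S) :
    Path c a b .bot (.piece i false false .bot) :=
  .of_equiv hS (le_of_atBot atBot_bot _) (le_of_atBot (by simp [AtBot, pos]) _)

theorem Path.last_top (hS : IsDistributiveSemilattice S) (i : S × S) :
    Path c a b (.piece i true true .top) .top :=
  .of_equiv hS (le_of_atTop atTop_top _) (le_of_atTop (by simp [AtTop, pos]) _)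

theorem Path.glue (hS : IsDistributiveSemilattice S) (i : S × S) (k : Bool) :
    Path c a b (.piece i k false .top) (.piece i k true .bot) :=
  .of_equiv hS (le_piece_iff.2 (by simp [pos])) (le_piece_iff.2 (by simp [pos, AtBot, AtTop]))

theorem Path.glue_halves (hS : IsDistributiveSemilattice S) (i : S × S) :
    Path c a b (.piece i false true .top) (.piece i true false .bot) :=
  .of_equiv hS (le_piece_iff.2 (by simp [pos])) (le_piece_iff.2 (by simp [pos, AtBot, AtTop]))

/-- The chain indexed by a splitting `c = x ⊔ y` with `x ≤ a` and `y ≤ b` joins the two ends. -/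
theorem Path.whole (hS : IsDistributiveSemilattice S) (h : c ≤ a ⊔ b) : Path c a b .bot .top := by
  obtain ⟨x, y, hx, hy, rfl⟩ := hS _ _ _ h
  -- Splittings with a zero part index no chain of their own, but then one step is enough.
  by_cases hx0 : x = ⊥
  · exact .single ⟨le_of_atBot atBot_bot _, .inr (by simpa [lower, height, hx0] using hy)⟩
  by_cases hy0 : y = ⊥
  · exact .single ⟨le_of_atBot atBot_bot _, .inl (by simpa [lower, height, hy0] using hx)⟩
  have h0 : part (x ⊔ y) (x, y) false = x := by simp [part, hx0, hy0]
  have h1 : part (x ⊔ y) (x, y) true = y := by simp [part, hx0, hy0]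
  have s0 : Path (part (x ⊔ y) (x, y) false) a b .bot .top :=
    .single ⟨le_of_atBot atBot_bot _, .inl (by simpa [lower, height, h0] using hx)⟩
  have s1 : Path (part (x ⊔ y) (x, y) true) a b .bot .top :=
    .single ⟨le_of_atBot atBot_bot _, .inr (by simpa [lower, height, h1] using hy)⟩
  exact (bot_first hS _).trans <| (s0.piece false).trans <| (glue hS _ _).trans <|
    (s1.piece false).trans <| (glue_halves hS _).trans <| (s0.piece true).trans <|
    (glue hS _ _).trans <| (s1.piece true).trans <| last_top hS _

theorem Path.half_up (hS : IsDistributiveSemilattice S) {i : S × S} {p : Bool}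
    {t : Point (S × S)} (ht : height (part c i p) (lower t) ≤ a ⊔ b → Path (part c i p) a b .bot t)
    (h : height c (.piece i p (lower t)) ≤ a ⊔ b) (k : Bool) :
    Path c a b (.piece i k false .bot) (.piece i k p t) := by
  cases p
  · exact (ht h).piece k
  · rw [height, _root_.sup_le_iff] at h
    exact ((whole hS h.1).piece k).trans <| (glue hS _ _).trans <| (ht h.2).piece k

theorem Path.half_down (hS : IsDistributiveSemilattice S) {i : S × S} {p : Bool}
    {t : Point (S × S)} (ht : depth (part c i p) (upper t) ≤ a ⊔ b → Path (part c i p) a b t .top)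
    (h : depth c (.piece i p (upper t)) ≤ a ⊔ b) (k : Bool) :
    Path c a b (.piece i k p t) (.piece i k true .top) := by
  cases p
  · rw [depth, _root_.sup_le_iff] at h
    exact ((ht h.1).piece k).trans <| (glue hS _ _).trans <| (whole hS h.2).piece k
  · exact (ht h).piece k

theorem Path.half (hS : IsDistributiveSemilattice S) (i : S × S) (h : c ≤ a ⊔ b) (k : Bool) :
    Path c a b (.piece i k false .bot) (.piece i k true .top) :=
  half_up hS (whole hS) (by simpa [lower, height, part_sup_part] using h) k

theorem Path.up (hS : IsDistributiveSemilattice S) {y : Point (S × S)}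
    (h : height c (lower y) ≤ a ⊔ b) : Path c a b .bot y := by
  induction y generalizing c with
  | bot => exact .refl
  | top => exact whole hS h
  | piece i k p t ih =>
    cases k
    · exact (bot_first hS i).trans (half_up hS ih h false)
    · exact (bot_first hS i).trans <| (half hS i h false).trans <| (glue_halves hS i).trans
        (half_up hS ih ((height_le _ _).trans h) true)

theorem Path.down (hS : IsDistributiveSemilattice S) {x : Point (S × S)}
    (h : depth c (upper x) ≤ a ⊔ b) : Path c a b x .top := by
  induction x generalizing c with
  | top => exact .refl
  | bot => exact whole hS h
  | piece i k p t ih =>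
    cases k
    · exact (half_down hS ih ((depth_le _ _).trans h) false).trans <| (glue_halves hS i).trans <|
        (half hS i h true).trans (last_top hS i)
    · exact (half_down hS ih h true).trans (last_top hS i)

theorem exists_path (hS : IsDistributiveSemilattice S) {x y : Point (S × S)} (hxy : le x y)
    (h : mu c y x ≤ a ⊔ b) : Path c a b x y := by
  induction x generalizing c y with
  | bot => exact .up hS (by simpa using h)
  | top => exact .of_equiv hS hxy (le_of_atTop atTop_top _)
  | piece i k p t ih =>
    rcases le_cases hxy with hx | hy | ha
    · refine (Path.of_equiv hS (le_of_atBot hx _) (le_of_atBot atBot_bot _)).trans (Path.up hS ?_)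
      have := height_le_mu_sup c y (.piece i k p t)
      rw [height_eq_bot hx, sup_bot_eq] at this
      exact this.trans h
    · refine .trans (Path.down hS ?_)
        (Path.of_equiv hS (le_of_atTop hy _) (le_of_atTop atTop_top _))
      have := depth_le_sup_mu c y (.piece i k p t)
      rw [depth_eq_bot hy, bot_sup_eq] at this
      exact this.trans h
    rcases y with _ | _ | ⟨j, l, q, s⟩
    · exact ha.elim
    · exact ha.elim
    obtain rfl : i = j := ha
    rw [le_piece_iff] at hxy
    rcases hxy with hlt | ⟨heq, hts⟩ | ⟨heq, ht, hs⟩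
    · rcases k with _ | _ <;> rcases l with _ | _
      · rcases p with _ | _ <;> rcases q with _ | _ <;> simp [pos] at hlt
        simp only [mu_piece_gt, _root_.sup_le_iff] at h
        exact ((Path.down hS h.2).piece _).trans ((Path.glue hS _ _).trans
          ((Path.up hS h.1).piece _))
      · simp only [mu_half_gt, _root_.sup_le_iff] at h
        exact (Path.half_down hS (Path.down hS) h.2 _).trans ((Path.glue_halves hS _).trans
          (Path.half_up hS (Path.up hS) h.1 _))
      · rcases p with _ | _ <;> rcases q with _ | _ <;> simp [pos] at hlt
      · rcases p with _ | _ <;> rcases q with _ | _ <;> simp [pos] at hlt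
        simp only [mu_piece_gt, _root_.sup_le_iff] at h
        exact ((Path.down hS h.2).piece _).trans ((Path.glue hS _ _).trans
          ((Path.up hS h.1).piece _))
    · obtain ⟨rfl, rfl⟩ := pos_inj.1 heq
      exact (ih hts (by simpa using h)).piece _
    · refine Path.of_equiv hS (le_piece_iff.2 (.inr (.inr ⟨heq, ht, hs⟩)))
        (le_piece_iff.2 (.inl (by omega)))

end measureOrder

/-! ### The lattice of equivalence classes -/

section quotient

variable {ι : Type u}

/-- The doubled interval itself, with equivalent points identified. -/
abbrev Interval (ι : Type u) : Type u :=
  Antisymmetrization (Point ι) (· ≤ ·)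

/-- The class of a point. -/
abbrev Interval.mk (x : Point ι) : Interval ι := toAntisymmetrization (· ≤ ·) x

/-- A point representing an element of the interval. -/
noncomputable abbrev Interval.out (x : Interval ι) : Point ι := ofAntisymmetrization (· ≤ ·) x

theorem Interval.out_mk_le (x : Point ι) : (Interval.mk x).out ≤ x :=
  toAntisymmetrization_le_toAntisymmetrization_iff.1
    (by rw [toAntisymmetrization_ofAntisymmetrization])

theorem Interval.le_out_mk (x : Point ι) : x ≤ (Interval.mk x).out :=
  toAntisymmetrization_le_toAntisymmetrization_iff.1
    (by rw [toAntisymmetrization_ofAntisymmetrization])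

noncomputable instance : Lattice (Interval ι) where
  inf x y := .mk (inf x.out y.out)
  sup x y := .mk (sup x.out y.out)
  inf_le_left _ _ := ofAntisymmetrization_le_ofAntisymmetrization_iff.1
    ((Interval.out_mk_le _).trans (inf_le _ _).1)
  inf_le_right _ _ := ofAntisymmetrization_le_ofAntisymmetrization_iff.1
    ((Interval.out_mk_le _).trans (inf_le _ _).2)
  le_inf _ _ _ hy hz := ofAntisymmetrization_le_ofAntisymmetrization_iff.1
    (le_trans (le_inf (ofAntisymmetrization_le_ofAntisymmetrization_iff.2 hy)
      (ofAntisymmetrization_le_ofAntisymmetrization_iff.2 hz)) (Interval.le_out_mk _))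
  le_sup_left _ _ := ofAntisymmetrization_le_ofAntisymmetrization_iff.1
    (le_trans (le_sup _ _).1 (Interval.le_out_mk _))
  le_sup_right _ _ := ofAntisymmetrization_le_ofAntisymmetrization_iff.1
    (le_trans (le_sup _ _).2 (Interval.le_out_mk _))
  sup_le _ _ _ hx hy := ofAntisymmetrization_le_ofAntisymmetrization_iff.1
    (le_trans (Interval.out_mk_le _)
      (sup_le (ofAntisymmetrization_le_ofAntisymmetrization_iff.2 hx)
        (ofAntisymmetrization_le_ofAntisymmetrization_iff.2 hy)))

noncomputable instance : BoundedOrder (Interval ι) where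
  bot := .mk .bot
  top := .mk .top
  bot_le _ := ofAntisymmetrization_le_ofAntisymmetrization_iff.1
    (le_trans (Interval.out_mk_le _) (le_of_atBot atBot_bot _))
  le_top _ := ofAntisymmetrization_le_ofAntisymmetrization_iff.1
    (le_trans (le_of_atTop atTop_top _) (Interval.le_out_mk _))

end quotient

theorem exists_fin_chain {α : Type u} {r : α → α → Prop} (hr : ∀ x, r x x) {x y : α}
    (h : Relation.ReflTransGen r x y) : ∃ n : ℕ, 0 < n ∧ ∃ z : Fin (n + 1) → α,
      z 0 = x ∧ z (Fin.last n) = y ∧ ∀ i : Fin n, r (z i.castSucc) (z i.succ) := by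
  induction h using Relation.ReflTransGen.head_induction_on with
  | refl => exact ⟨1, one_pos, fun _ => y, rfl, rfl, fun _ => hr y⟩
  | @head a b hab _ ih =>
    obtain ⟨n, -, z, hz0, hzn, hz⟩ := ih
    refine ⟨n + 1, n.succ_pos, Fin.cons a z, rfl, ?_, ?_⟩
    · rw [← Fin.succ_last, Fin.cons_succ, hzn]
    · intro i
      cases i using Fin.cases with
      | zero => simpa [hz0] using hab
      | succ i => simpa using hz i

section representation

variable {S : Type u} [SemilatticeSup S] [OrderBot S]

/-- The measure on the doubled interval of value `c`, computed on representatives. -/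
noncomputable def measure (c : S) (x y : Interval (S × S)) : S := mu c x.out y.out

theorem measure_mk (hS : IsDistributiveSemilattice S) (c : S) (x y : Point (S × S)) :
    measure c (.mk x) (.mk y) = mu c x y := by
  have aux : ∀ {x x' y y' : Point (S × S)}, x ≤ x' → y' ≤ y → mu c x y ≤ mu c x' y' := by
    intro x x' y y' hx hy
    refine (mu_triangle hS c x x' y).trans ?_
    rw [mu_eq_bot_of_le hS c hx, bot_sup_eq]
    refine (mu_triangle hS c x' y' y).trans ?_
    rw [mu_eq_bot_of_le hS c hy, sup_bot_eq]
  exact le_antisymm (aux (Interval.out_mk_le x) (Interval.le_out_mk y))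
    (aux (Interval.le_out_mk x) (Interval.out_mk_le y))

/-- An element `s ≠ ⊥` is the height of the first division point of the chain `(s, c)`, since
`s ⊔ c = c` for the largest element `c`. -/
theorem isPMeasureRepresentation_measure (hS : IsDistributiveSemilattice S) {c : S}
    (hc : c ≠ ⊥) (hc' : IsTop c) : IsPMeasureRepresentation (measure c) where
  triangle x y z := mu_triangle hS c _ _ _
  eq_bot_of_le x y h :=
    mu_eq_bot_of_le hS c (ofAntisymmetrization_le_ofAntisymmetrization_iff.2 h)
  pos x y h := by
    refine bot_lt_iff_ne_bot.2 fun h0 => h.not_ge ?_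
    exact ofAntisymmetrization_le_ofAntisymmetrization_iff.1 (le_of_mu_eq_bot hc
      (ofAntisymmetrization_le_ofAntisymmetrization_iff.2 h.le) h0)
  refine x y hxy a b h := by
    have hp := exists_path hS (ofAntisymmetrization_le_ofAntisymmetrization_iff.2 hxy) h
    obtain ⟨n, hn, z, hz0, hzn, hz⟩ := exists_fin_chain
      (fun x => ⟨le_refl x, .inl (by rw [mu_eq_bot_of_le hS c (le_refl x)]; exact bot_le)⟩) hp
    refine ⟨n, hn, fun i => .mk (z i), ?_, ?_, fun i => ?_, fun i => ?_⟩
    · simp only [hz0]; exact toAntisymmetrization_ofAntisymmetrization _ _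
    · simp only [hzn]; exact toAntisymmetrization_ofAntisymmetrization _ _
    · exact toAntisymmetrization_le_toAntisymmetrization_iff.2 (hz i).1
    · rw [measure_mk hS]; exact (hz i).2
  generates := by
    refine Set.eq_univ_of_forall fun s => subset_supClosure ?_
    by_cases hs : s = ⊥
    · exact ⟨⊥, (mu_eq_bot_of_le hS c (le_refl _)).trans hs.symm⟩
    · refine ⟨.mk (.piece (s, c) false false .top), (measure_mk hS c _ .bot).trans ?_⟩
      simp [lower, height, part, hs, hc, hc' s]

end representation

end DoubledInterval

/-! ### Semilattices without a largest element -/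

theorem IsDistributiveSemilattice.withTop {S : Type u} [SemilatticeSup S] [OrderBot S]
    (hS : IsDistributiveSemilattice S) : IsDistributiveSemilattice (WithTop S) := by
  intro a b c h
  by_cases ha : a = ⊤
  · exact ⟨c, ⊥, by simp [ha], bot_le, by simp⟩
  by_cases hb : b = ⊤
  · exact ⟨⊥, c, bot_le, by simp [hb], by simp⟩
  lift a to S using ha
  lift b to S using hb
  lift c to S using ne_top_of_le_ne_top (WithTop.coe_ne_top (a := a ⊔ b)) (by simpa using h)
  obtain ⟨x, y, hx, hy, rfl⟩ := hS a b c (by exact_mod_cast h)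
  exact ⟨x, y, by exact_mod_cast hx, by exact_mod_cast hy, by simp⟩

/-- A representation over `WithTop S`, restricted to the lower set of points of height below `⊤`,
is a representation over `S`. -/
theorem exists_representation_of_withTop {S : Type u} [SemilatticeSup S] [OrderBot S]
    {P : Type v} [Lattice P] [OrderBot P] {μ : P → P → WithTop S}
    (hμ : IsPMeasureRepresentation μ) :
    ∃ (Q : Type v) (_ : SemilatticeInf Q) (_ : OrderBot Q) (ν : Q → Q → S),
      IsPMeasureRepresentation ν ∧ ∀ F : Set Q, F.Finite → BddAbove F → ∃ j : Q, IsLUB F j := by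
  have mono : ∀ {x y : P}, x ≤ y → μ x ⊥ ≤ μ y ⊥ := fun {x y} h => by
    simpa [hμ.eq_bot_of_le _ _ h] using hμ.triangle x y ⊥
  have bound : ∀ x y : P, μ x y ≤ μ x ⊥ := fun x y => by
    simpa [hμ.eq_bot_of_le ⊥ y bot_le] using hμ.triangle x ⊥ y
  have fin : ∀ (x : {x : P // μ x ⊥ ≠ ⊤}) (y : P), μ x y ≠ ⊤ := fun x y =>
    ne_top_of_le_ne_top x.2 (bound _ _)
  let _ : SemilatticeInf {x : P // μ x ⊥ ≠ ⊤} :=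
    Subtype.semilatticeInf fun {x y} hx _ => ne_top_of_le_ne_top hx (mono inf_le_left)
  let _ : OrderBot {x : P // μ x ⊥ ≠ ⊤} :=
    Subtype.orderBot (by simp [hμ.eq_bot_of_le _ _ le_rfl])
  let ν : {x : P // μ x ⊥ ≠ ⊤} → {x : P // μ x ⊥ ≠ ⊤} → S := fun x y => (μ x y).untop (fin x y)
  have hν : ∀ x y, (ν x y : WithTop S) = μ x y := fun x y => WithTop.coe_untop _ _
  refine ⟨{x : P // μ x ⊥ ≠ ⊤}, _, _, ν, ⟨⟨?_, ?_⟩, ?_, ?_, ?_⟩, ?_⟩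
  · intro x y z
    rw [← WithTop.coe_le_coe, WithTop.coe_sup, hν, hν, hν]
    exact hμ.triangle _ _ _
  · intro x y h
    rw [← WithTop.coe_inj, hν]
    exact hμ.eq_bot_of_le _ _ h
  · intro x y h
    rw [← WithTop.coe_lt_coe, hν]
    exact hμ.pos _ _ h
  · intro x y hxy a b h
    rw [← WithTop.coe_le_coe, WithTop.coe_sup, hν] at h
    obtain ⟨n, hn, z, hz0, hzn, hz, hzμ⟩ := hμ.refine _ _ hxy _ _ h
    have hzy : ∀ i, z i ≤ y := fun i => hzn ▸ Fin.monotone_iff_le_succ.2 hz (Fin.le_last i)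
    refine ⟨n, hn, fun i => ⟨z i, ne_top_of_le_ne_top y.2 (mono (hzy i))⟩, Subtype.ext hz0,
      Subtype.ext hzn, hz, fun i => ?_⟩
    simp only [← WithTop.coe_le_coe (α := S), hν]
    exact hzμ i
  · refine Set.eq_univ_of_forall fun s => ?_
    -- Finite elements of the join-closure are joins of finite values.
    have key : supClosure (Set.range fun x : P => μ x ⊥) ⊆
        {w | ∀ s : S, w = s → s ∈ supClosure (Set.range fun x => ν x ⊥)} := by
      refine supClosure_min ?_ ?_
      · rintro _ ⟨x, rfl⟩ s hs
        refine subset_supClosure ⟨⟨x, hs.trans_ne WithTop.coe_ne_top⟩, ?_⟩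
        rw [← WithTop.coe_inj, hν]
        exact hs
      · intro w hw w' hw' s hs
        have h1 : w ≠ ⊤ := by rintro rfl; simp at hs
        have h2 : w' ≠ ⊤ := by rintro rfl; simp at hs
        lift w to S using h1
        lift w' to S using h2
        obtain rfl : w ⊔ w' = s := by exact_mod_cast hs
        exact supClosed_supClosure (hw w rfl) (hw' w' rfl)
    exact key (hμ.generates.symm ▸ Set.mem_univ _) s rfl
  · rintro F hF ⟨u, hu⟩
    have hFu : hF.toFinset.sup Subtype.val ≤ (u : P) :=
      Finset.sup_le fun x hx => hu (hF.mem_toFinset.1 hx)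
    refine ⟨⟨_, ne_top_of_le_ne_top u.2 (mono hFu)⟩, fun x hx => ?_, fun v hv => ?_⟩
    · exact Finset.le_sup (f := Subtype.val) (hF.mem_toFinset.2 hx)
    · exact Finset.sup_le fun x hx => hv (hF.mem_toFinset.1 hx)

theorem corollaryC (S : Type u) [SemilatticeSup S] [OrderBot S]
    (hS : IsDistributiveSemilattice S) :
    (∃ (P : Type u) (_ : SemilatticeInf P) (_ : OrderBot P) (μ : P → P → S),
      IsPMeasureRepresentation μ ∧
      ∀ F : Set P, F.Finite → BddAbove F → ∃ j : P, IsLUB F j) ∧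
    ((∃ t : S, IsTop t) →
      ∃ (P : Type u) (_ : Lattice P) (_ : BoundedOrder P) (μ : P → P → S),
        IsPMeasureRepresentation μ) := by
  constructor
  · exact exists_representation_of_withTop
      (DoubledInterval.isPMeasureRepresentation_measure
        (hS.withTop) (c := ⊤) top_ne_bot isTop_top)
  · rintro ⟨t, ht⟩
    by_cases h : t = ⊥
    · have hS : ∀ s : S, s = ⊥ := fun s => bot_unique ((ht s).trans_eq h)
      refine ⟨PUnit, inferInstance, inferInstance, fun _ _ => ⊥, ⟨⟨?_, ?_⟩, ?_, ?_, ?_⟩⟩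
      · simp
      · simp
      · exact fun x y hxy => (lt_irrefl _ hxy).elim
      · exact fun x y _ a b _ => ⟨1, one_pos, fun _ => x, rfl, rfl, by simp, by simp⟩
      · exact Set.eq_univ_of_forall fun s => subset_supClosure ⟨⟨⟩, (hS s).symm⟩
    · exact ⟨_, _, _, _, DoubledInterval.isPMeasureRepresentation_measure hS h ht⟩
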